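/- Let $G$ be a group, $H\leqslant G$ a subgroup and $g\in G$. The order $\mathrm{Ord}_H(g)$ of $g$ in $H$ is the least integer $k\geqslant 1$ such that $g^k\in H$, or $0$ if there is no such $k$; the spectrum of $G$ with respect to $H$ is $\mathrm{Ord}_H(G)=\{\mathrm{Ord}_H(g) : g\in G\}$. (1) Let $\mathcal O\neq\{0\}$ be a set of non-negative integers that contains $0$ and contains every positive divisor of each of its nonzero elements. Then there exist a finitely generated torsion-free group $G$ and a finitely generated subgroup $H\leqslant G$ such that $\mathrm{Ord}_H(G)=\mathcal O$. (2) Consequently, there exist a finitely generated torsion-free group $G$ and a finitely generated subgroup $H\leqslant G$ such that $\mathrm{Ord}_H(G)$ is not computably enumerable; and there also exist such $G$ and $H$ for which $\mathrm{Ord}_H(G)$ is computably enumerable but not computable. -/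

import Mathlib

/-- The relative order of `g` in a subset `S` of a group: the least `k ≥ 1` with `g ^ k ∈ S`,
and `0` if there is no such `k` (the infimum of the empty set of naturals is `0`). -/
noncomputable def relOrder {G : Type*} [Group G] (S : Set G) (g : G) : ℕ :=
  sInf {k : ℕ | 1 ≤ k ∧ g ^ k ∈ S}

/-- The spectrum of `G` with respect to `S`: the set of all relative orders in `S` of elements
of `G`. -/
def relSpectrum {G : Type*} [Group G] (S : Set G) : Set ℕ :=
  {k : ℕ | ∃ g : G, relOrder S g = k}

/-- A group is torsion-free if only the identity has finite order. (Mathlib's `IsMulTorsionFree`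
asks for unique roots, which is stronger for nonabelian groups.) -/
def TorsionFreeGroup (G : Type*) [Group G] : Prop :=
  ∀ g : G, IsOfFinOrder g → g = 1

/-- Every divisor of a nonzero element of `O` lies in `O`. The element `0` imposes no condition:
it stands for infinite order, and counting all integers as its divisors would leave only `O = ℕ`. -/
def DivisorClosed (O : Set ℕ) : Prop :=
  ∀ n ∈ O, n ≠ 0 → ∀ d : ℕ, d ∣ n → d ∈ O

/-! Let K be the free product of the cyclic groups ℤ/n over the positive n in O. Torsion in K is
conjugate into a factor, so divisor closure puts every finite order in O. The standard characters of
the factors glue to χ : K → ℝ/ℤ, which kills no nontrivial torsion; hence the pullback E of ℝ → ℝ/ℤ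
along χ is torsion-free. It is a central extension of K by an infinite cyclic ⟨z⟩, and the order of
an element relative to ⟨z⟩ is the order of its image in K.

E need not be finitely generated. A double wreath product with ℤ embeds E root-closed in a
torsion-free group having a two-generator subgroup G that contains z and a root of z for each n.
Elements of G outside E have relative order 0, so H = ⟨z⟩ has spectrum O.

For (2), Fermat numbers are pairwise coprime and exceed 1, so their divisors encode any S ⊆ ℕ in a
divisor-closed set; take S to be the halting set or its complement. -/

/-! ### Torsion in free products -/

namespace Monoid.CoprodI.NeWord

variable {ι : Type*} {M : ι → Type*} [∀ i, Monoid (M i)]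

theorem prod_ne_one [DecidableEq ι] [∀ i, DecidableEq (M i)] {i j : ι} (w : NeWord M i j) :
    w.prod ≠ 1 := by
  intro h
  have h' : w.toWord = Word.empty :=
    Word.equiv.symm.injective (by simpa [Word.equiv, NeWord.prod] using h)
  exact w.toList_ne_nil (congrArg Word.toList h')

/-- Copies of a word whose end letters lie in different factors concatenate without cancellation. -/
theorem exists_prod_eq_pow {i j : ι} (w : NeWord M i j) (hij : i ≠ j) (k : ℕ) :
    ∃ w' : NeWord M i j, w'.prod = w.prod ^ (k + 1) := by
  induction k with
  | zero => exact ⟨w, by simp⟩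
  | succ k ih =>
    obtain ⟨w', hw'⟩ := ih
    exact ⟨w'.append hij.symm w, by rw [append_prod, hw', pow_succ _ (k + 1)]⟩

/-- Splitting off the last letter of a reduced word. -/
theorem eq_singleton_or_exists_append_singleton {i j : ι} (w : NeWord M i j) :
    (i = j ∧ ∃ a : M j, w.prod = of a) ∨
      ∃ (k : ι) (w' : NeWord M i k) (a : M j), k ≠ j ∧ a ≠ 1 ∧ w.prod = w'.prod * of a ∧
        w'.toList.length < w.toList.length := by
  induction w with
  | singleton x hx => exact Or.inl ⟨rfl, x, by simp⟩
  | @append i j k l w₁ hne w₂ _ ih =>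
    right
    rcases ih with h | ⟨m, w', a, hm, ha, hp, hl⟩
    · obtain ⟨rfl, a, ha⟩ := h
      refine ⟨j, w₁, a, hne, ?_, by rw [append_prod, ha], ?_⟩
      · classical
        rintro rfl
        exact w₂.prod_ne_one (by simpa using ha)
      · simpa using List.length_pos_iff.2 w₂.toList_ne_nil
    · exact ⟨m, w₁.append hne w', a, hm, ha, by simp [hp, mul_assoc], by simpa using hl⟩

/-- Splitting off the first letter of a reduced word. -/
theorem eq_singleton_or_exists_singleton_append {i j : ι} (w : NeWord M i j) :
    (i = j ∧ ∃ a : M i, w.prod = of a) ∨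
      ∃ (k : ι) (w' : NeWord M k j) (a : M i), k ≠ i ∧ a ≠ 1 ∧ w.prod = of a * w'.prod ∧
        w'.toList.length < w.toList.length := by
  induction w with
  | singleton x hx => exact Or.inl ⟨rfl, x, by simp⟩
  | @append i j k l w₁ hne w₂ ih _ =>
    right
    rcases ih with h | ⟨m, w', a, hm, ha, hp, hl⟩
    · obtain ⟨rfl, a, ha⟩ := h
      refine ⟨k, w₂, a, hne.symm, ?_, by rw [append_prod, ha], ?_⟩
      · classical
        rintro rfl
        exact w₁.prod_ne_one (by simpa using ha)
      · simpa using List.length_pos_iff.2 w₁.toList_ne_nil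
    · exact ⟨m, w'.append hne w₂, a, hm, ha, by simp [hp, mul_assoc], by simpa using hl⟩

theorem not_isOfFinOrder_prod {i j : ι} (w : NeWord M i j) (hij : i ≠ j) :
    ¬ IsOfFinOrder w.prod := by
  classical
  intro h
  obtain ⟨n, hn, h⟩ := isOfFinOrder_iff_pow_eq_one.1 h
  obtain ⟨w', hw'⟩ := w.exists_prod_eq_pow hij (n - 1)
  rw [Nat.sub_add_cancel hn, h] at hw'
  exact w'.prod_ne_one hw'

end Monoid.CoprodI.NeWord

namespace Monoid.CoprodI

variable {ι : Type*} {G : ι → Type*} [∀ i, Group (G i)]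

/-- Cyclic reduction, by induction on length: a word starting and ending in the same factor is
conjugated to bring its last letter to the front. -/
theorem NeWord.exists_conj_of_isOfFinOrder (n : ℕ) : ∀ {i j : ι} (w : NeWord G i j),
    w.toList.length ≤ n → IsOfFinOrder w.prod →
      ∃ (l : ι) (a : G l) (u : CoprodI G), w.prod = u * of a * u⁻¹ := by
  induction n with
  | zero =>
    intro i j w hl
    exact absurd (List.length_eq_zero_iff.1 (Nat.le_zero.1 hl)) w.toList_ne_nil
  | succ n ih =>
    intro i j w hl hfin
    by_cases hij : i = j
    · subst hij
      rcases w.eq_singleton_or_exists_append_singleton with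
        ⟨-, a, ha⟩ | ⟨k, w₁, c, hk, -, hp, hl₁⟩
      · exact ⟨i, a, 1, by simpa using ha⟩
      rcases w₁.eq_singleton_or_exists_singleton_append with
        ⟨h, -⟩ | ⟨m, w₂, a, hm, -, hp', hl₂⟩
      · exact absurd h.symm hk
      have hconj : w.prod = (of c)⁻¹ * (of (c * a) * w₂.prod) * ((of c)⁻¹)⁻¹ := by
        rw [hp, hp', map_mul]
        group
      have hfin' : IsOfFinOrder (of (c * a) * w₂.prod) := by
        refine (isConj_iff.2 ⟨of c, ?_⟩ : IsConj w.prod _).isOfFinOrder hfin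
        rw [hconj]
        group
      -- Either the end letters cancel and the shorter `w₂` remains, or the merged word has ends in
      -- different factors and hence infinite order.
      by_cases hca : c * a = 1
      · rw [hca, map_one, one_mul] at hconj hfin'
        obtain ⟨l, b, u, hb⟩ := ih w₂ (by omega) hfin'
        exact ⟨l, b, (of c)⁻¹ * u, by rw [hconj, hb]; group⟩
      · exact absurd (by simpa using hfin')
          (((NeWord.singleton (c * a) hca).append hm.symm w₂).not_isOfFinOrder_prod hk.symm)
    · exact absurd hfin (w.not_isOfFinOrder_prod hij)

/-- An element of finite order of a free product is conjugate to an element of a factor. -/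
theorem eq_one_or_exists_conj_of_isOfFinOrder (x : CoprodI G) (hx : IsOfFinOrder x) :
    x = 1 ∨ ∃ (l : ι) (a : G l) (u : CoprodI G), x = u * of a * u⁻¹ := by
  classical
  by_cases h : Word.equiv x = Word.empty
  · left
    rw [← Word.equiv.symm_apply_apply x, h]
    rfl
  · right
    obtain ⟨i, j, w, hw⟩ := NeWord.of_word _ h
    have hwx : w.prod = x := by
      rw [NeWord.prod, hw]
      exact Word.equiv.symm_apply_apply x
    subst hwx
    exact NeWord.exists_conj_of_isOfFinOrder _ w le_rfl hx

end Monoid.CoprodI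

/-! ### Relative orders -/

theorem relOrder_congr {G G' : Type*} [Group G] [Group G'] {S : Set G} {S' : Set G'}
    {g : G} {g' : G'} (h : ∀ k : ℕ, 1 ≤ k → (g ^ k ∈ S ↔ g' ^ k ∈ S')) : relOrder S g = relOrder S' g' := by
  unfold relOrder
  congr 1
  ext k
  exact and_congr_right (h k)

theorem relOrder_eq_zero_of_forall {G : Type*} [Group G] {S : Set G} {g : G}
    (h : ∀ k : ℕ, 1 ≤ k → g ^ k ∉ S) : relOrder S g = 0 :=
  Nat.sInf_eq_zero.2 (Or.inr (Set.eq_empty_iff_forall_notMem.2 fun k hk => h k hk.1 hk.2))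

theorem relOrder_singleton_one {G : Type*} [Group G] (g : G) :
    relOrder ({1} : Set G) g = orderOf g := by
  by_cases hg : IsOfFinOrder g
  · refine le_antisymm (Nat.sInf_le ⟨hg.orderOf_pos, pow_orderOf_eq_one g⟩) ?_
    refine le_csInf ⟨orderOf g, hg.orderOf_pos, pow_orderOf_eq_one g⟩ ?_
    rintro k ⟨hk, h⟩
    exact orderOf_le_of_pow_eq_one hk h
  · rw [orderOf_eq_zero hg]
    exact relOrder_eq_zero_of_forall fun k hk h =>
      hg (isOfFinOrder_iff_pow_eq_one.2 ⟨k, hk, h⟩)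

/-! ### The torsion-free central extension -/

section CirclePullback

variable {K : Type*} [Group K]

/-- The quotient map from the reals to the circle, written multiplicatively. -/
noncomputable def realToCircle : Multiplicative ℝ →* Multiplicative UnitAddCircle :=
  AddMonoidHom.toMultiplicative (QuotientAddGroup.mk' (AddSubgroup.zmultiples (1 : ℝ)))

theorem realToCircle_eq_one_iff (r : Multiplicative ℝ) :
    realToCircle r = 1 ↔ ∃ n : ℤ, (n : ℝ) = r.toAdd := by
  change ((r.toAdd : ℝ) : UnitAddCircle) = 0 ↔ _
  rw [AddCircle.coe_eq_zero_iff]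
  simp

/-- The central extension of `K` by the integers obtained by pulling back the universal cover of
the circle along a character of `K`. -/
noncomputable def circlePullback (χ : K →* Multiplicative UnitAddCircle) :
    Subgroup (K × Multiplicative ℝ) :=
  (χ.comp (MonoidHom.fst K (Multiplicative ℝ))).eqLocus
    (realToCircle.comp (MonoidHom.snd K (Multiplicative ℝ)))

theorem mem_circlePullback {χ : K →* Multiplicative UnitAddCircle} {p : K × Multiplicative ℝ} :
    p ∈ circlePullback χ ↔ χ p.1 = realToCircle p.2 := Iff.rfl

/-- The generator of the kernel of the projection of `circlePullback χ` to `K`. -/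
noncomputable def circlePullbackCenter (χ : K →* Multiplicative UnitAddCircle) :
    circlePullback χ :=
  ⟨(1, Multiplicative.ofAdd 1), by
    rw [mem_circlePullback, map_one]
    exact ((realToCircle_eq_one_iff _).2 ⟨1, by simp⟩).symm⟩

/-- Since ℝ is torsion-free, a torsion element has trivial real coordinate, so its first coordinate
is torsion in the kernel of χ. -/
theorem torsionFreeGroup_circlePullback {χ : K →* Multiplicative UnitAddCircle}
    (hχ : ∀ x : K, IsOfFinOrder x → χ x = 1 → x = 1) :
    TorsionFreeGroup (circlePullback χ) := by
  rintro ⟨⟨x, r⟩, hp⟩ hfin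
  have hx : IsOfFinOrder x :=
    ((MonoidHom.fst K (Multiplicative ℝ)).comp (circlePullback χ).subtype).isOfFinOrder hfin
  have hr : IsOfFinOrder r :=
    ((MonoidHom.snd K (Multiplicative ℝ)).comp (circlePullback χ).subtype).isOfFinOrder hfin
  have hr1 : r = 1 := by
    by_contra h
    exact not_isOfFinOrder_of_isMulTorsionFree h hr
  subst hr1
  have hx1 : x = 1 := hχ x hx (by simpa using mem_circlePullback.1 hp)
  subst hx1
  rfl

theorem mem_zpowers_circlePullbackCenter_iff {χ : K →* Multiplicative UnitAddCircle}
    (p : circlePullback χ) :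
    p ∈ Subgroup.zpowers (circlePullbackCenter χ) ↔ (p : K × Multiplicative ℝ).1 = 1 := by
  constructor
  · rintro ⟨n, rfl⟩
    simp [circlePullbackCenter]
  · obtain ⟨⟨x, r⟩, hp⟩ := p
    rintro (rfl : x = 1)
    rw [mem_circlePullback, map_one, eq_comm] at hp
    obtain ⟨n, hn⟩ := (realToCircle_eq_one_iff r).1 hp
    refine ⟨n, Subtype.ext (Prod.ext (by simp [circlePullbackCenter]) ?_)⟩
    apply Multiplicative.toAdd.injective
    simpa [circlePullbackCenter] using hn

theorem relOrder_zpowers_circlePullbackCenter {χ : K →* Multiplicative UnitAddCircle}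
    (p : circlePullback χ) :
    relOrder (Subgroup.zpowers (circlePullbackCenter χ) : Set (circlePullback χ)) p =
      orderOf (p : K × Multiplicative ℝ).1 := by
  rw [← relOrder_singleton_one]
  refine relOrder_congr fun k _ => ?_
  rw [SetLike.mem_coe, mem_zpowers_circlePullbackCenter_iff]
  simp

end CirclePullback

/-! ### Torsion and roots in wreath products -/

namespace RegularWreathProduct

variable {D Q : Type*} [Group D] [Group Q]

/-- The embedding of the base group into the wreath product. -/
def base : (Q → D) →* D ≀ᵣ Q where
  toFun f := ⟨f, 1⟩
  map_one' := rfl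
  map_mul' f g := by ext <;> simp

theorem base_injective : Function.Injective (base : (Q → D) →* D ≀ᵣ Q) := fun _ _ h =>
  congrArg left h

theorem base_left_of_right_eq_one {g : D ≀ᵣ Q} (h : g.right = 1) : base g.left = g := by
  ext <;> simp [base, h]

/-- The embedding of `D` as the coordinate subgroup of the base group at the identity. -/
def coord [DecidableEq Q] : D →* D ≀ᵣ Q :=
  base.comp (MonoidHom.mulSingle (fun _ : Q => D) 1)

theorem coord_injective [DecidableEq Q] : Function.Injective (coord : D →* D ≀ᵣ Q) :=
  fun _ _ h => Pi.mulSingle_injective (M := fun _ : Q => D) 1 (base_injective h)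

theorem inl_mul_base_mul_inl_inv (q : Q) (f : Q → D) :
    inl q * base f * (inl q)⁻¹ = base fun x => f (q⁻¹ * x) := by
  ext <;> simp [base]

theorem right_eq_one_of_pow_right (hQ : TorsionFreeGroup Q) {g : D ≀ᵣ Q} {k : ℕ} (hk : k ≠ 0)
    (h : (g ^ k).right = 1) : g.right = 1 :=
  hQ _ (isOfFinOrder_iff_pow_eq_one.2 ⟨k, Nat.pos_of_ne_zero hk,
    (map_pow (rightHom : D ≀ᵣ Q →* Q) g k).symm.trans h⟩)

theorem torsionFreeGroup (hD : TorsionFreeGroup D) (hQ : TorsionFreeGroup Q) :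
    TorsionFreeGroup (D ≀ᵣ Q) := by
  intro g hg
  obtain ⟨k, hk, h⟩ := isOfFinOrder_iff_pow_eq_one.1 hg
  have hr := right_eq_one_of_pow_right hQ hk.ne' (congrArg right h)
  rw [← base_left_of_right_eq_one hr] at h ⊢
  rw [← map_pow, ← map_one base] at h
  have h' := base_injective h
  have : g.left = 1 := funext fun x =>
    hD _ (isOfFinOrder_iff_pow_eq_one.2 ⟨k, hk, congrFun h' x⟩)
  rw [this, map_one]

/-- In a torsion-free wreath product a coordinate subgroup is closed under taking roots. -/
theorem exists_eq_coord_of_pow [DecidableEq Q] (hD : TorsionFreeGroup D)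
    (hQ : TorsionFreeGroup Q) {g : D ≀ᵣ Q} {k : ℕ} (hk : k ≠ 0) {d : D} (h : g ^ k = coord d) :
    ∃ c : D, g = coord c := by
  have hr : g.right = 1 := right_eq_one_of_pow_right hQ hk (congrArg right h)
  rw [← base_left_of_right_eq_one hr, ← map_pow] at h
  have h' : g.left ^ k = Pi.mulSingle 1 d := base_injective h
  refine ⟨g.left 1, ?_⟩
  rw [← base_left_of_right_eq_one hr]
  refine congrArg base (funext fun x => ?_)
  by_cases hx : x = 1
  · subst hx
    simp [base]
  · rw [MonoidHom.mulSingle_apply, Pi.mulSingle_eq_of_ne hx]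
    refine hD _ (isOfFinOrder_iff_pow_eq_one.2 ⟨k, Nat.pos_of_ne_zero hk, ?_⟩)
    simpa [Pi.mulSingle_eq_of_ne hx] using congrFun h' x

end RegularWreathProduct

/-! ### Embedding a sequence in a two-generator subgroup -/

open RegularWreathProduct
open scoped commutatorElement

theorem torsionFreeGroup_multiplicative_int : TorsionFreeGroup (Multiplicative ℤ) := by
  intro g hg
  by_contra h
  exact not_isOfFinOrder_of_isMulTorsionFree h hg

section SparseEmbedding

variable {A : Type*} [Group A]

/-- The translation in a wreath product with the integers. -/
def wreathShift : A ≀ᵣ Multiplicative ℤ := inl (Multiplicative.ofAdd 1)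

/-- The element of the base group which is constantly `a` on the nonnegative integers and trivial
on the negative ones. -/
def halfLine (a : A) : A ≀ᵣ Multiplicative ℤ :=
  base fun x => if 0 ≤ x.toAdd then a else 1

/-- A half-line divided by its translate by one leaves only the value at the origin. -/
theorem commutator_halfLine_wreathShift (a : A) :
    ⁅halfLine a, (wreathShift : A ≀ᵣ Multiplicative ℤ)⁆ = coord a := by
  have : ⁅halfLine a, (wreathShift : A ≀ᵣ Multiplicative ℤ)⁆ =
      halfLine a * (wreathShift * halfLine a⁻¹ * wreathShift⁻¹) := by
    have hinv : (halfLine a)⁻¹ = halfLine a⁻¹ := by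
      rw [halfLine, ← map_inv, halfLine]
      congr 1
      ext x
      by_cases hx : 0 ≤ x.toAdd <;> simp [hx]
    rw [commutatorElement_def, hinv]
    simp only [mul_assoc]
  rw [this, wreathShift, halfLine, halfLine, inl_mul_base_mul_inl_inv, ← map_mul]
  refine congrArg base (funext fun x => ?_)
  obtain ⟨n, rfl⟩ := Multiplicative.ofAdd.surjective x
  rcases lt_trichotomy n 0 with hn | rfl | hn
  · have h1 : ¬ 0 ≤ n := by omega
    have h2 : ¬ 1 ≤ n := by omega
    have h3 : Multiplicative.ofAdd n ≠ 1 := fun h => hn.ne (Multiplicative.ofAdd.injective h)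
    simp [h1, h2, Pi.mulSingle_eq_of_ne h3]
  · simp
  · have h1 : 0 ≤ n := by omega
    have h2 : 1 ≤ n := by omega
    have h3 : Multiplicative.ofAdd n ≠ 1 := fun h => hn.ne' (Multiplicative.ofAdd.injective h)
    simp [h1, h2, Pi.mulSingle_eq_of_ne h3]

/-- A function on the integers carrying the translation at `0` and the half-line elements of all
members of a sequence at the positive odd integers. -/
def interleave (a : ℕ → A) (x : Multiplicative ℤ) : A ≀ᵣ Multiplicative ℤ :=
  if x.toAdd = 0 then wreathShift
  else if 0 < x.toAdd ∧ Odd x.toAdd then halfLine (a (x.toAdd.natAbs / 2)) else 1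

/-- An odd shift sends positive odd integers to positive even ones, where `interleave a` is trivial;
so the two entries are both nontrivial at most at the origin. -/
theorem commutator_interleave (a : ℕ → A) (n : ℕ) (x : Multiplicative ℤ) :
    ⁅interleave a (Multiplicative.ofAdd (2 * n + 1 : ℤ) * x), interleave a x⁆ =
      (Pi.mulSingle 1 (coord (a n)) : Multiplicative ℤ → A ≀ᵣ Multiplicative ℤ) x := by
  obtain ⟨m, rfl⟩ := Multiplicative.ofAdd.surjective x
  by_cases hm : m = 0
  · subst hm
    have h1 : (2 * n + 1 : ℤ) ≠ 0 := by omega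
    have h2 : (2 * n + 1 : ℤ).natAbs / 2 = n := by omega
    rw [ofAdd_zero, mul_one, Pi.mulSingle_eq_same, ← commutator_halfLine_wreathShift]
    have h3 : (0 : ℤ) < 2 * n + 1 := by omega
    have h4 : interleave a (Multiplicative.ofAdd (2 * n + 1 : ℤ)) = halfLine (a n) := by
      have h5 : Odd (2 * n + 1 : ℤ) := ⟨n, rfl⟩
      simp only [interleave, toAdd_ofAdd, h1, h2, h3, h5, and_self, if_true, if_false]
    rw [h4]
    simp [interleave]
  · have h3 : Multiplicative.ofAdd m ≠ 1 := fun h => hm (Multiplicative.ofAdd.injective h)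
    rw [Pi.mulSingle_eq_of_ne h3]
    by_cases hodd : 0 < m ∧ Odd m
    · have h4 : ¬ (2 * n + 1 + m : ℤ) = 0 := by omega
      have h5 : ¬ Odd (2 * n + 1 + m : ℤ) := by
        rw [Int.not_odd_iff_even]
        exact Odd.add_odd ⟨n, rfl⟩ hodd.2
      have : interleave a (Multiplicative.ofAdd (2 * n + 1 : ℤ) * Multiplicative.ofAdd m) = 1 := by
        rw [← ofAdd_add]
        simp only [interleave, toAdd_ofAdd, h4, h5, and_false, if_false]
      rw [this, commutatorElement_one_left]
    · have : interleave a (Multiplicative.ofAdd m) = 1 := by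
        simp only [interleave, toAdd_ofAdd, hm, hodd, if_false]
      rw [this, commutatorElement_one_right]

/-- The base element of the iterated wreath product with coordinates `interleave a`. -/
def interleaveBase (a : ℕ → A) : (A ≀ᵣ Multiplicative ℤ) ≀ᵣ Multiplicative ℤ :=
  base (interleave a)

theorem coord_coord_mem_closure (a : ℕ → A) (n : ℕ) :
    coord (coord (a n)) ∈ Subgroup.closure
      {interleaveBase a, (wreathShift : (A ≀ᵣ Multiplicative ℤ) ≀ᵣ Multiplicative ℤ)} := by
  set G := Subgroup.closure
    {interleaveBase a, (wreathShift : (A ≀ᵣ Multiplicative ℤ) ≀ᵣ Multiplicative ℤ)}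
  have hF : interleaveBase a ∈ G := Subgroup.subset_closure (by simp)
  have hT : (inl (Multiplicative.ofAdd (2 * n + 1 : ℤ))⁻¹ :
      (A ≀ᵣ Multiplicative ℤ) ≀ᵣ Multiplicative ℤ) ∈ G := by
    have h : (wreathShift : (A ≀ᵣ Multiplicative ℤ) ≀ᵣ Multiplicative ℤ) ^ (-(2 * n + 1 : ℤ)) ∈ G :=
      G.zpow_mem (Subgroup.subset_closure (by simp)) _
    rwa [wreathShift, ← map_zpow, ← ofAdd_zsmul, smul_eq_mul, mul_one, ofAdd_neg] at h
  have key : coord (coord (a n)) =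
      ⁅inl (Multiplicative.ofAdd (2 * n + 1 : ℤ))⁻¹ * interleaveBase a *
        (inl (Multiplicative.ofAdd (2 * n + 1 : ℤ))⁻¹)⁻¹, interleaveBase a⁆ := by
    rw [interleaveBase, inl_mul_base_mul_inl_inv, ← map_commutatorElement]
    refine congrArg base (funext fun x => ?_)
    rw [inv_inv]
    exact (commutator_interleave a n x).symm
  rw [key, commutatorElement_def]
  have hFT := G.mul_mem (G.mul_mem hT hF) (G.inv_mem hT)
  exact G.mul_mem (G.mul_mem (G.mul_mem hFT hF) (G.inv_mem hFT)) (G.inv_mem hF)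

/-- Every sequence in a torsion-free group lies in a finitely generated torsion-free overgroup in
which the given group is closed under taking roots. -/
theorem exists_fg_overgroup_of_sequence {A : Type} [Group A] (hA : TorsionFreeGroup A)
    (a : ℕ → A) :
    ∃ (W : Type) (_ : Group W) (ε : A →* W) (G : Subgroup W),
      TorsionFreeGroup W ∧ Function.Injective ε ∧ G.FG ∧ (∀ n, ε (a n) ∈ G) ∧
      (∀ (g : W) (k : ℕ) (b : A), k ≠ 0 → g ^ k = ε b → ∃ c, g = ε c) ∧
      ∃ t ∈ G, ∀ c, t ≠ ε c := by
  have hZ := torsionFreeGroup_multiplicative_int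
  have hW := RegularWreathProduct.torsionFreeGroup hA hZ
  refine ⟨(A ≀ᵣ Multiplicative ℤ) ≀ᵣ Multiplicative ℤ, inferInstance, coord.comp coord,
    Subgroup.closure {interleaveBase a, wreathShift},
    RegularWreathProduct.torsionFreeGroup hW hZ, coord_injective.comp coord_injective,
    (Subgroup.fg_iff _).2 ⟨_, rfl, Set.toFinite _⟩, coord_coord_mem_closure a, ?_,
    wreathShift, Subgroup.subset_closure (by simp), ?_⟩
  · intro g k b hk h
    obtain ⟨d, rfl⟩ := exists_eq_coord_of_pow hW hZ hk h
    rw [← map_pow] at h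
    obtain ⟨c, rfl⟩ := exists_eq_coord_of_pow hA hZ hk (coord_injective h)
    exact ⟨c, rfl⟩
  · intro c h
    have h' : (Multiplicative.ofAdd 1 : Multiplicative ℤ) = 1 := congrArg right h
    exact one_ne_zero (Multiplicative.ofAdd.injective h')

end SparseEmbedding

/-! ### The free product of cyclic groups and its character -/

section CyclicFreeProduct

open Monoid

/-- The positive elements of a set of natural numbers. -/
abbrev PositiveMembers (O : Set ℕ) : Type := {n : ℕ // n ∈ O ∧ n ≠ 0}

instance (O : Set ℕ) (n : PositiveMembers O) : NeZero (n : ℕ) := ⟨n.2.2⟩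

/-- The free product of the cyclic groups whose orders are the positive elements of `O`. -/
abbrev CyclicFreeProduct (O : Set ℕ) : Type :=
  CoprodI fun n : PositiveMembers O => Multiplicative (ZMod n)

/-- The character of `CyclicFreeProduct O` which is the standard embedding on each factor. -/
noncomputable def cyclicCharacter (O : Set ℕ) :
    CyclicFreeProduct O →* Multiplicative UnitAddCircle :=
  CoprodI.lift fun _ => AddMonoidHom.toMultiplicative ZMod.toAddCircle

theorem cyclicCharacter_of {O : Set ℕ} {n : PositiveMembers O} (a : ZMod n) :
    cyclicCharacter O (CoprodI.of (i := n) (Multiplicative.ofAdd a)) =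
      Multiplicative.ofAdd (ZMod.toAddCircle a) :=
  CoprodI.lift_of _ _

theorem eq_one_of_cyclicCharacter_eq_one {O : Set ℕ} (x : CyclicFreeProduct O)
    (hx : IsOfFinOrder x) (h : cyclicCharacter O x = 1) : x = 1 := by
  rcases CoprodI.eq_one_or_exists_conj_of_isOfFinOrder x hx with rfl | ⟨n, a, u, rfl⟩
  · rfl
  obtain ⟨a, rfl⟩ := Multiplicative.ofAdd.surjective a
  rw [map_mul, map_mul, map_inv, mul_inv_cancel_comm, cyclicCharacter_of] at h
  have ha : a = 0 := ZMod.toAddCircle_eq_zero.1 (Multiplicative.ofAdd.injective h)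
  simp [ha]

theorem orderOf_mem_of_isOfFinOrder {O : Set ℕ} (hO : DivisorClosed O) (h1 : 1 ∈ O)
    (x : CyclicFreeProduct O) (hx : IsOfFinOrder x) : orderOf x ∈ O := by
  rcases CoprodI.eq_one_or_exists_conj_of_isOfFinOrder x hx with rfl | ⟨n, a, u, rfl⟩
  · rwa [orderOf_one]
  refine hO n n.2.1 n.2.2 _ (orderOf_dvd_of_pow_eq_one ?_)
  have ha : a ^ (n : ℕ) = 1 := by
    obtain ⟨a, rfl⟩ := Multiplicative.ofAdd.surjective a
    rw [← ofAdd_nsmul]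
    simp
  rw [conj_pow, ← map_pow, ha, map_one, mul_one, mul_inv_cancel]

theorem orderOf_of_ofAdd_one {O : Set ℕ} (n : PositiveMembers O) :
    orderOf (CoprodI.of (i := n) (Multiplicative.ofAdd 1) : CyclicFreeProduct O) = n := by
  rw [orderOf_injective _ (CoprodI.of_injective n), orderOf_ofAdd_eq_addOrderOf,
    ZMod.addOrderOf_one]

/-- The root of the central element of `circlePullback (cyclicCharacter O)` belonging to a factor
of `CyclicFreeProduct O`. -/
noncomputable def cyclicRoot {O : Set ℕ} (n : PositiveMembers O) : circlePullback (cyclicCharacter O) :=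
  ⟨(CoprodI.of (i := n) (Multiplicative.ofAdd 1), Multiplicative.ofAdd (1 / (n : ℕ) : ℝ)), by
    rw [mem_circlePullback, cyclicCharacter_of]
    have h := ZMod.toAddCircle_natCast (N := n) 1
    rw [Nat.cast_one, Nat.cast_one] at h
    rw [h]
    rfl⟩

end CyclicFreeProduct

/-! ### Realizing a prescribed spectrum -/

theorem DivisorClosed.one_mem {O : Set ℕ} (hO : DivisorClosed O) (h0 : 0 ∈ O) (hne : O ≠ {0}) :
    1 ∈ O := by
  by_contra h1
  refine hne (Set.eq_singleton_iff_unique_mem.2 ⟨h0, fun n hn => ?_⟩)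
  by_contra h
  exact h1 (hO n hn h 1 (one_dvd n))

theorem exists_fg_torsionFree_relSpectrum_eq {O : Set ℕ} (hO : DivisorClosed O) (h0 : 0 ∈ O)
    (hne : O ≠ {0}) :
    ∃ (G : Type) (_ : Group G) (H : Subgroup G),
      Group.FG G ∧ TorsionFreeGroup G ∧ H.FG ∧ relSpectrum (H : Set G) = O := by
  classical
  have h1 := hO.one_mem h0 hne
  set z := circlePullbackCenter (cyclicCharacter O)
  -- The default value is `z`, so the index `0` forces `z` itself into the two-generator subgroup.
  let a : ℕ → circlePullback (cyclicCharacter O) := fun n =>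
    if h : n ∈ O ∧ n ≠ 0 then cyclicRoot ⟨n, h⟩ else z
  obtain ⟨W, _, ε, G, hW, hε, hG, ha, hroot, t, ht, htε⟩ := exists_fg_overgroup_of_sequence
    (torsionFreeGroup_circlePullback eq_one_of_cyclicCharacter_eq_one) a
  have hzG : ε z ∈ G := by simpa [a] using ha 0
  have hmem : ∀ (g : G) (k : ℕ),
      g ^ k ∈ Subgroup.zpowers (⟨ε z, hzG⟩ : G) ↔ (g : W) ^ k ∈ Subgroup.zpowers (ε z) := by
    intro g k
    simp only [Subgroup.mem_zpowers_iff, Subtype.ext_iff, Subgroup.coe_zpow, Subgroup.coe_pow]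
  have hord : ∀ (g : G) (c : circlePullback (cyclicCharacter O)), (g : W) = ε c →
      relOrder (Subgroup.zpowers (⟨ε z, hzG⟩ : G) : Set G) g =
        orderOf (c : CyclicFreeProduct O × Multiplicative ℝ).1 := by
    intro g c hgc
    rw [← relOrder_zpowers_circlePullbackCenter]
    refine relOrder_congr fun k _ => ?_
    rw [SetLike.mem_coe, hmem, hgc, ← map_pow, ← MonoidHom.map_zpowers, SetLike.mem_coe,
      Subgroup.mem_map_iff_mem hε]
  have hroot' : ∀ (g : G) (k : ℕ), 1 ≤ k → g ^ k ∈ Subgroup.zpowers (⟨ε z, hzG⟩ : G) →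
      ∃ c, (g : W) = ε c := by
    intro g k hk h
    obtain ⟨m, hm⟩ := (hmem g k).1 h
    exact hroot g k (z ^ m) (by omega) (hm.symm.trans (map_zpow ε z m).symm)
  refine ⟨G, inferInstance, Subgroup.zpowers ⟨ε z, hzG⟩, (Group.fg_iff_subgroup_fg G).2 hG, ?_,
    ?_, Set.Subset.antisymm ?_ ?_⟩
  · exact fun g hg => Subtype.ext (hW g (G.subtype.isOfFinOrder hg))
  · exact (Subgroup.fg_iff _).2 ⟨{⟨ε z, hzG⟩}, (Subgroup.zpowers_eq_closure _).symm,
      Set.finite_singleton _⟩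
  · rintro n ⟨g, rfl⟩
    by_cases hg : ∃ c, (g : W) = ε c
    · obtain ⟨c, hc⟩ := hg
      rw [hord g c hc]
      by_cases hfin : IsOfFinOrder (c : CyclicFreeProduct O × Multiplicative ℝ).1
      · exact orderOf_mem_of_isOfFinOrder hO h1 _ hfin
      · rwa [orderOf_eq_zero hfin]
    · rwa [relOrder_eq_zero_of_forall fun k hk h => hg (hroot' g k hk h)]
  · intro n hn
    by_cases hn0 : n = 0
    · subst hn0
      -- By root-closure `t`, lying outside the image of `ε`, has no positive power in ⟨z⟩.
      refine ⟨⟨t, ht⟩, relOrder_eq_zero_of_forall fun k hk h => ?_⟩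
      obtain ⟨c, hc⟩ := hroot' ⟨t, ht⟩ k hk h
      exact htε c hc
    · have han : a n = cyclicRoot ⟨n, hn, hn0⟩ := dif_pos ⟨hn, hn0⟩
      refine ⟨⟨ε (a n), ha n⟩, ?_⟩
      rw [hord _ (a n) rfl, han]
      exact orderOf_of_ofAdd_one ⟨n, hn, hn0⟩

/-! ### Coding undecidable sets by divisors of Fermat numbers -/

section FermatDivisors

/-- The divisors of the Fermat numbers with index in `S`, together with `0`. -/
def fermatDivisors (S : Set ℕ) : Set ℕ :=
  {d | d = 0 ∨ ∃ n ∈ S, d ∣ Nat.fermatNumber n}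

theorem divisorClosed_fermatDivisors (S : Set ℕ) : DivisorClosed (fermatDivisors S) := by
  rintro n (rfl | ⟨m, hm, hd⟩) hn d hdn
  · exact absurd rfl hn
  · exact Or.inr ⟨m, hm, hdn.trans hd⟩

theorem zero_mem_fermatDivisors (S : Set ℕ) : 0 ∈ fermatDivisors S := Or.inl rfl

theorem fermatNumber_mem_fermatDivisors_iff {S : Set ℕ} {n : ℕ} :
    Nat.fermatNumber n ∈ fermatDivisors S ↔ n ∈ S := by
  constructor
  · rintro (h | ⟨m, hm, hd⟩)
    · simp [Nat.fermatNumber] at h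
    · by_contra hn
      have hnm : n ≠ m := fun h => hn (h ▸ hm)
      have h1 := Nat.Coprime.eq_one_of_dvd (Nat.coprime_fermatNumber_fermatNumber hnm) hd
      simp [Nat.fermatNumber] at h1
  · exact fun h => Or.inr ⟨n, h, dvd_rfl⟩

theorem fermatDivisors_ne_singleton {S : Set ℕ} (hS : S.Nonempty) : fermatDivisors S ≠ {0} := by
  obtain ⟨n, hn⟩ := hS
  intro h
  have := fermatNumber_mem_fermatDivisors_iff.2 hn
  rw [h] at this
  simp [Nat.fermatNumber] at this

theorem primrec_fermatNumber : Primrec Nat.fermatNumber := by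
  -- Iterated squaring from 2 computes 2^(2^n).
  have h : Primrec fun n : ℕ => Nat.rec (motive := fun _ => ℕ) 2 (fun _ y => y * y) n :=
    Primrec.nat_rec₁ 2 ((Primrec.nat_mul.comp Primrec.snd Primrec.snd).to₂)
  refine (Primrec.succ.comp h).of_eq fun n => ?_
  rw [Nat.fermatNumber, Nat.succ_eq_add_one]
  congr 1
  induction n with
  | zero => rfl
  | succ n ih =>
    rw [pow_succ, pow_mul, ← ih, sq]

theorem REPred.comp_computable {α β : Type*} [Primcodable α] [Primcodable β] {p : β → Prop}
    (hp : REPred p) {f : α → β} (hf : Computable f) : REPred fun a => p (f a) :=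
  Partrec.comp hp hf

theorem ComputablePred.comp_computable {α β : Type*} [Primcodable α] [Primcodable β]
    {p : β → Prop} (hp : ComputablePred p) {f : α → β} (hf : Computable f) :
    ComputablePred fun a => p (f a) := by
  obtain ⟨g, hg, rfl⟩ := ComputablePred.computable_iff.1 hp
  exact ComputablePred.computable_iff.2 ⟨fun a => g (f a), hg.comp hf, rfl⟩

open Nat.Partrec (Code)

/-- The indices of the programs which halt on input `0`. -/
def haltingIndices : Set ℕ := {n | ((Denumerable.ofNat Code n).eval 0).Dom}

theorem mem_haltingIndices_encode (c : Code) :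
    Encodable.encode c ∈ haltingIndices ↔ (c.eval 0).Dom := by
  simp [haltingIndices]

theorem computable_fermatNumber_encode :
    Computable fun c : Code => Nat.fermatNumber (Encodable.encode c) :=
  (primrec_fermatNumber.comp Primrec.encode).to_comp

theorem not_rePred_fermatDivisors_compl :
    ¬ REPred fun n : ℕ => n ∈ fermatDivisors haltingIndicesᶜ := by
  intro h
  refine ComputablePred.halting_problem_not_re 0
    ((h.comp_computable computable_fermatNumber_encode).of_eq fun c => ?_)
  rw [fermatNumber_mem_fermatDivisors_iff, Set.mem_compl_iff, mem_haltingIndices_encode]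

theorem not_computablePred_fermatDivisors :
    ¬ ComputablePred fun n : ℕ => n ∈ fermatDivisors haltingIndices := by
  intro h
  refine ComputablePred.halting_problem 0 ?_
  have hcode := h.comp_computable computable_fermatNumber_encode
  simpa only [fermatNumber_mem_fermatDivisors_iff, mem_haltingIndices_encode] using hcode

/-- A bounded search witnessing membership in `fermatDivisors haltingIndices`. -/
def fermatDivisorsSearch (d m : ℕ) : Bool :=
  d == 0 || (Nat.fermatNumber m.unpair.1 % d == 0 &&
    (Code.evaln m.unpair.2 (Denumerable.ofNat Code m.unpair.1) 0).isSome)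

theorem primrec_fermatDivisorsSearch : Primrec₂ fermatDivisorsSearch := by
  have hn : Primrec fun p : ℕ × ℕ => p.2.unpair.1 :=
    Primrec.fst.comp (Primrec.unpair.comp Primrec.snd)
  have hk : Primrec fun p : ℕ × ℕ => p.2.unpair.2 :=
    Primrec.snd.comp (Primrec.unpair.comp Primrec.snd)
  refine Primrec.or.comp (Primrec.beq.comp Primrec.fst (Primrec.const 0))
    (Primrec.and.comp (Primrec.beq.comp
      (Primrec.nat_mod.comp (primrec_fermatNumber.comp hn) Primrec.fst) (Primrec.const 0))
      (Primrec.option_isSome.comp ?_))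
  exact Code.primrec_evaln.comp (((hk.pair ((Primrec.ofNat Code).comp hn))).pair (Primrec.const 0))

theorem exists_fermatDivisorsSearch_iff (d : ℕ) :
    (∃ m, fermatDivisorsSearch d m = true) ↔ d ∈ fermatDivisors haltingIndices := by
  constructor
  · rintro ⟨m, hm⟩
    simp only [fermatDivisorsSearch, Bool.or_eq_true, Bool.and_eq_true, beq_iff_eq,
      Option.isSome_iff_exists] at hm
    rcases hm with h | ⟨h, x, hx⟩
    · exact Or.inl h
    · exact Or.inr ⟨_, Part.dom_iff_mem.2 ⟨x, Code.evaln_sound hx⟩, Nat.dvd_of_mod_eq_zero h⟩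
  · rintro (rfl | ⟨n, hn, hd⟩)
    · exact ⟨0, by simp [fermatDivisorsSearch]⟩
    · obtain ⟨x, hx⟩ := Part.dom_iff_mem.1 hn
      obtain ⟨k, hk⟩ := Code.evaln_complete.1 hx
      -- A witness pairs a program index with a bound sufficient for its evaluation.
      refine ⟨Nat.pair n k, ?_⟩
      simp only [fermatDivisorsSearch, Bool.or_eq_true, Bool.and_eq_true, beq_iff_eq,
        Option.isSome_iff_exists, Nat.unpair_pair]
      exact Or.inr ⟨Nat.mod_eq_zero_of_dvd hd, x, hk⟩

theorem rePred_fermatDivisors : REPred fun n : ℕ => n ∈ fermatDivisors haltingIndices := by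
  have h : Partrec fun d : ℕ => Nat.rfind fun m => Part.some (fermatDivisorsSearch d m) :=
    Partrec.rfind primrec_fermatDivisorsSearch.to_comp.partrec₂
  refine h.dom_re.of_eq fun d => ?_
  rw [← exists_fermatDivisorsSearch_iff]
  exact Nat.rfind_dom.trans (exists_congr fun m =>
    ⟨fun h => (Part.mem_some_iff.1 h.1).symm, fun h => ⟨Part.mem_some_iff.2 h.symm, fun _ => trivial⟩⟩)

theorem haltingIndices_nonempty : haltingIndices.Nonempty :=
  ⟨Encodable.encode Code.zero, (mem_haltingIndices_encode _).2 trivial⟩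

theorem haltingIndices_compl_nonempty : haltingIndicesᶜ.Nonempty := by
  obtain ⟨c, hc⟩ := Code.exists_code.1 Nat.Partrec.none
  refine ⟨Encodable.encode c, ?_⟩
  rw [Set.mem_compl_iff, mem_haltingIndices_encode, hc]
  exact id

end FermatDivisors

theorem mainTheorem1 :
    (∀ O : Set ℕ, DivisorClosed O → 0 ∈ O → O ≠ {0} →
      ∃ (G : Type) (_ : Group G) (H : Subgroup G),
        Group.FG G ∧ TorsionFreeGroup G ∧ H.FG ∧ relSpectrum (H : Set G) = O) ∧
    (∃ (G : Type) (_ : Group G) (H : Subgroup G),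
        Group.FG G ∧ TorsionFreeGroup G ∧ H.FG ∧
        ¬ REPred (fun n : ℕ => n ∈ relSpectrum (H : Set G))) ∧
    (∃ (G : Type) (_ : Group G) (H : Subgroup G),
        Group.FG G ∧ TorsionFreeGroup G ∧ H.FG ∧
        REPred (fun n : ℕ => n ∈ relSpectrum (H : Set G)) ∧
        ¬ ComputablePred (fun n : ℕ => n ∈ relSpectrum (H : Set G))) := by
  refine ⟨fun O hO h0 hne => exists_fg_torsionFree_relSpectrum_eq hO h0 hne, ?_, ?_⟩
  · obtain ⟨G, inst, H, hG, hT, hH, hs⟩ := exists_fg_torsionFree_relSpectrum_eq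
      (divisorClosed_fermatDivisors haltingIndicesᶜ) (zero_mem_fermatDivisors _)
      (fermatDivisors_ne_singleton haltingIndices_compl_nonempty)
    exact ⟨G, inst, H, hG, hT, hH, hs ▸ not_rePred_fermatDivisors_compl⟩
  · obtain ⟨G, inst, H, hG, hT, hH, hs⟩ := exists_fg_torsionFree_relSpectrum_eq
      (divisorClosed_fermatDivisors haltingIndices) (zero_mem_fermatDivisors _)
      (fermatDivisors_ne_singleton haltingIndices_nonempty)
    exact ⟨G, inst, H, hG, hT, hH, hs ▸ rePred_fermatDivisors,
      hs ▸ not_computablePred_fermatDivisors⟩
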